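/- A dcpo is a poset $L$ in which every (nonempty) directed subset has a supremum; it carries the Scott topology, and it is *well-filtered* if, whenever $\mathcal C$ is a filter basis of compact saturated (= compact upper) subsets and $U$ is an open subset with $\bigcap\mathcal C\subseteq U$, some $K\in\mathcal C$ satisfies $K\subseteq U$. Let $\mathbf{WF}$ be the category of well-filtered dcpos and Scott continuous maps. Two monads on $\mathbf{WF}$ are considered. * The Hoare power monad $(\mathcal H,\eta,\mu)$: $\mathcal H(L)$ is the set of all Scott closed subsets of $L$ (including $\emptyset$) ordered by inclusion, $\mathcal H(f)(A)=\mathrm{cl}(f(A))$, $\eta_L(x)={\downarrow}x$, $\mu_L(\mathcal A)=\bigcup\mathcal A$. * The Smyth power monad $(\mathcal Q,\theta,\iota)$: $\mathcal Q(L)$ is the set of all nonempty Scott compact saturated subsets of $L$ ordered by reverse inclusion, $\mathcal Q(f)(K)={\uparrow}f(K)$, $\theta_L(x)={\uparrow}x$, $\iota_L(\mathcal K)=\bigcup\mathcal K$. The maps $\phi_L:\mathcal H(\mathcal Q(L))\to\mathcal Q(\mathcal H(L))$, $\phi_L(\mathcal A)=\{A\in\mathcal H(L): A\cap K\neq\emptyset\text{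 for all }K\in\mathcal A\}$, form a distributive law $\phi:\mathcal{HQ}\to\mathcal{QH}$ of $\mathcal Q$ over $\mathcal H$. Hence $\mathcal{QH}$ is a monad on $\mathbf{WF}$ with unit $\theta_{\mathcal H}\circ\eta$ and multiplication $\mathcal Q\mu\circ\iota_{\mathcal{HH}}\circ\mathcal Q\phi_{\mathcal H}$. **Theorem.** 1. If $(L,\alpha)$ is an Eilenberg–Moore algebra of $\mathcal{QH}$ and $\phi_L$ is an isomorphism in $\mathbf{WF}$, then $L$ is a frame. (In particular, if $\phi$ is an isomorphism, every $\mathcal{QH}$-algebra is a frame.) 2. Every $\mathcal{QH}$-algebra homomorphism $h:(L,\alpha)\to(M,\beta)$ preserves arbitrary suprema and the infima of all nonempty finite sets. 3. If, moreover, $\phi_L$ and $\phi_M$ are isomorphisms (so that $L$ and $M$ are frames), then $h$ is a frame homomorphism in the strict sense, which also requires that the greatest element (the empty infimum) be preserved, if and only if $h$ maps the greatest element of $L$ to the greatest element of $M$. 4. A well-filtered dcpo carries at most one $\mathcal{QH}$-algebra structure map. Consequently, if $\phi$ is an isomorphism, the Eilenberg–Moore category of $\mathcal{QH}$ over $\mathbf{WF}$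 is a subcategory of the category of frames and maps that preserve arbitrary suprema and nonempty finite infima. -/

import Mathlib

open CategoryTheory

universe u v w

namespace WFPower

/-! ### The Scott topology, compactness and well-filteredness -/

section Scott

variable {P : Type u} [PartialOrder P] {Q : Type v} [PartialOrder Q]

/-- Open sets of the Scott topology. -/
def ScottOpen (U : Set P) : Prop := @IsOpen P (Topology.scott P Set.univ) U

/-- Closed sets of the Scott topology. -/
def ScottClosed (A : Set P) : Prop := @IsClosed P (Topology.scott P Set.univ) A

/-- Compact sets of the Scott topology. -/
def ScottCompact (K : Set P) : Prop := @IsCompact P (Topology.scott P Set.univ) K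

/-- Closure in the Scott topology. -/
def scottClosure (A : Set P) : Set P := @closure P (Topology.scott P Set.univ) A

variable (P) in
/-- A poset is well-filtered if its Scott topology is: whenever the intersection of a filter basis
of compact saturated sets lies in an open set `U`, some member of the basis lies in `U`.
(The specialization order of the Scott topology is the given order, so the saturated sets are the
upper sets.) -/
def WellFiltered : Prop :=
  ∀ C : Set (Set P), C.Nonempty → DirectedOn (fun K L => L ⊆ K) C →
    (∀ K ∈ C, ScottCompact K ∧ IsUpperSet K) →
    ∀ U : Set P, ScottOpen U → ⋂₀ C ⊆ U → ∃ K ∈ C, K ⊆ U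

theorem scottOpen_iff {U : Set P} : ScottOpen U ↔ IsUpperSet U ∧ DirSupInacc U := by
  let : TopologicalSpace P := Topology.scott P Set.univ
  have : Topology.IsScott P Set.univ := ⟨rfl⟩
  have := Topology.IsScott.isOpen_iff_isUpperSet_and_dirSupInaccOn (D := Set.univ) (s := U)
  rwa [dirSupInaccOn_univ] at this

theorem scottClosed_iff {A : Set P} : ScottClosed A ↔ IsLowerSet A ∧ DirSupClosed A := by
  let : TopologicalSpace P := Topology.scott P Set.univ
  have : Topology.IsScott P Set.univ := ⟨rfl⟩
  exact Topology.IsScott.isClosed_iff_isLowerSet_and_dirSupClosed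

theorem ScottClosed.lower {A : Set P} (h : ScottClosed A) : IsLowerSet A := (scottClosed_iff.1 h).1

theorem ScottOpen.upper {A : Set P} (h : ScottOpen A) : IsUpperSet A := (scottOpen_iff.1 h).1

theorem ScottClosed.compl {A : Set P} (h : ScottClosed A) : ScottOpen Aᶜ :=
  (@isOpen_compl_iff P A (Topology.scott P Set.univ)).2 h

theorem ScottOpen.compl {A : Set P} (h : ScottOpen A) : ScottClosed Aᶜ :=
  (@isClosed_compl_iff P (Topology.scott P Set.univ) A).2 h

theorem subset_scottClosure (A : Set P) : A ⊆ scottClosure A :=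
  @subset_closure P (Topology.scott P Set.univ) A

theorem scottClosed_closure (A : Set P) : ScottClosed (scottClosure A) :=
  @isClosed_closure P (Topology.scott P Set.univ) A

theorem scottClosure_subset {A B : Set P} (hB : ScottClosed B) (h : A ⊆ B) : scottClosure A ⊆ B :=
  @closure_minimal P (Topology.scott P Set.univ) A B h hB

theorem scottClosed_sInter {S : Set (Set P)} (h : ∀ A ∈ S, ScottClosed A) : ScottClosed (⋂₀ S) :=
  @isClosed_sInter P (Topology.scott P Set.univ) S h

theorem scottOpen_sUnion {S : Set (Set P)} (h : ∀ A ∈ S, ScottOpen A) : ScottOpen (⋃₀ S) :=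
  @isOpen_sUnion P (Topology.scott P Set.univ) S h

theorem scottClosed_Iic (a : P) : ScottClosed (Set.Iic a) :=
  scottClosed_iff.2 ⟨isLowerSet_Iic a, dirSupClosed_Iic a⟩

theorem ScottCompact.inter_closed {K A : Set P} (hK : ScottCompact K) (hA : ScottClosed A) :
    ScottCompact (K ∩ A) :=
  @IsCompact.inter_right P (Topology.scott P Set.univ) K A hK hA

theorem scottClosed_preimage {f : P → Q} (hf : ScottContinuous f) {B : Set Q}
    (hB : ScottClosed B) : ScottClosed (f ⁻¹' B) := by
  rw [scottClosed_iff] at hB ⊢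
  refine ⟨hB.1.preimage hf.monotone, fun d hd hne hdir a ha => ?_⟩
  refine hB.2 (d := f '' d) ?_ (hne.image f) ?_ (hf hne hdir ha)
  · rintro _ ⟨x, hx, rfl⟩
    exact hd hx
  · rintro _ ⟨x, hx, rfl⟩ _ ⟨y, hy, rfl⟩
    obtain ⟨z, hz, hxz, hyz⟩ := hdir x hx y hy
    exact ⟨f z, ⟨z, hz, rfl⟩, hf.monotone hxz, hf.monotone hyz⟩

theorem scottOpen_preimage {f : P → Q} (hf : ScottContinuous f) {B : Set Q}
    (hB : ScottOpen B) : ScottOpen (f ⁻¹' B) := by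
  have := (scottClosed_preimage hf hB.compl).compl
  rwa [Set.preimage_compl, compl_compl] at this

theorem ScottCompact.elim {K : Set P} (hK : ScottCompact K) {ι : Type w} [Nonempty ι]
    (U : ι → Set P) (hU : ∀ i, ScottOpen (U i)) (hd : Directed (· ⊆ ·) U) (hc : K ⊆ ⋃ i, U i) :
    ∃ i, K ⊆ U i :=
  @IsCompact.elim_directed_cover P (Topology.scott P Set.univ) K ι _ hK U hU hc hd

theorem scottCompact_of_directed {K : Set P}
    (h : ∀ D : Set (Set P), D.Nonempty → DirectedOn (· ⊆ ·) D → (∀ U ∈ D, ScottOpen U) →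
      K ⊆ ⋃₀ D → ∃ U ∈ D, K ⊆ U) : ScottCompact K := by
  let : TopologicalSpace P := Topology.scott P Set.univ
  refine isCompact_of_finite_subcover fun {ι} U hU hc => ?_
  classical
  have hd : DirectedOn (· ⊆ ·) (Set.range fun t : Finset ι => ⋃ i ∈ t, U i) := by
    rintro _ ⟨s, rfl⟩ _ ⟨t, rfl⟩
    exact ⟨_, ⟨s ∪ t, rfl⟩,
      Set.biUnion_subset_biUnion_left fun i hi => Finset.mem_union_left _ hi,
      Set.biUnion_subset_biUnion_left fun i hi => Finset.mem_union_right _ hi⟩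
  have ho : ∀ V ∈ Set.range fun t : Finset ι => ⋃ i ∈ t, U i, ScottOpen V := by
    rintro _ ⟨t, rfl⟩
    exact isOpen_biUnion fun i _ => hU i
  have hK : K ⊆ ⋃₀ Set.range fun t : Finset ι => ⋃ i ∈ t, U i := by
    intro x hx
    obtain ⟨i, hi⟩ := Set.mem_iUnion.1 (hc hx)
    exact ⟨_, ⟨{i}, rfl⟩, by simpa using hi⟩
  obtain ⟨_, ⟨t, rfl⟩, hV⟩ := h _ (Set.range_nonempty _) hd ho hK
  exact ⟨t, hV⟩

/-- The saturation `{y | ∃ x ∈ K, f x ≤ y}` of the image of a compact set is compact. -/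
theorem ScottCompact.up_image {f : P → Q} (hf : ScottContinuous f) {K : Set P}
    (hK : ScottCompact K) : ScottCompact {y | ∃ x ∈ K, f x ≤ y} := by
  refine scottCompact_of_directed fun D hne hdir hop hc => ?_
  have := hne.to_subtype
  obtain ⟨⟨U, hU⟩, hKU⟩ := hK.elim (fun U : D => f ⁻¹' U.1)
    (fun U => scottOpen_preimage hf (hop _ U.2))
    (fun U V => by
      obtain ⟨W, hW, h1, h2⟩ := hdir _ U.2 _ V.2
      exact ⟨⟨W, hW⟩, Set.preimage_mono h1, Set.preimage_mono h2⟩)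
    (fun x hx => by
      obtain ⟨U, hU, hxU⟩ := hc ⟨x, hx, le_rfl⟩
      exact Set.mem_iUnion.2 ⟨⟨U, hU⟩, hxU⟩)
  refine ⟨U, hU, ?_⟩
  rintro y ⟨x, hx, hxy⟩
  exact (hop U hU).upper hxy (hKU hx)

/-- A filter basis of compact sets none of which lies in `U` has a minimal closed transversal
that avoids `U`. -/
theorem exists_minimal_transversal {C : Set (Set P)}
    (hcomp : ∀ K ∈ C, ScottCompact K) {U : Set P} (hU : ScottOpen U)
    (hno : ∀ K ∈ C, ¬ K ⊆ U) :
    ∃ A : Set P, ScottClosed A ∧ A ⊆ Uᶜ ∧ (∀ K ∈ C, (K ∩ A).Nonempty) ∧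
      ∀ B, ScottClosed B → B ⊆ A → (∀ K ∈ C, (K ∩ B).Nonempty) → A ⊆ B := by
  obtain ⟨A, hAU, hA⟩ := zorn_superset_nonempty
    {A : Set P | ScottClosed A ∧ ∀ K ∈ C, (K ∩ A).Nonempty} (fun c hc hch hne => by
      refine ⟨⋂₀ c, ⟨scottClosed_sInter fun A hA => (hc hA).1, fun K hK => ?_⟩,
        fun s hs => Set.sInter_subset_of_mem hs⟩
      by_contra hemp
      rw [Set.not_nonempty_iff_eq_empty] at hemp
      have := hne.to_subtype
      obtain ⟨⟨B, hB⟩, hKB⟩ := (hcomp K hK).elim (fun B : c => B.1ᶜ)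
        (fun B => (hc B.2).1.compl)
        (fun B B' => by
          rcases hch.total B.2 B'.2 with h | h
          · exact ⟨B, subset_rfl, Set.compl_subset_compl.2 h⟩
          · exact ⟨B', Set.compl_subset_compl.2 h, subset_rfl⟩)
        (fun x hx => by
          by_contra hx'
          have : x ∈ K ∩ ⋂₀ c := ⟨hx, fun B hB => by
            by_contra hxB
            exact hx' (Set.mem_iUnion.2 ⟨⟨B, hB⟩, hxB⟩)⟩
          rw [hemp] at this
          exact this)
      obtain ⟨x, hx, hxB⟩ := (hc hB).2 K hK
      exact hKB hx hxB) Uᶜ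
    ⟨hU.compl, fun K hK => by
      obtain ⟨x, hx, hxU⟩ := Set.not_subset.1 (hno K hK)
      exact ⟨x, hx, hxU⟩⟩
  exact ⟨A, hA.1.1, hAU, hA.1.2, fun B hB hBA hBK => hA.2 ⟨hB, hBK⟩ hBA⟩

/-! ### Complete lattices -/

section Complete

theorem exists_join (hs : ∀ S : Set P, ∃ a, IsLUB S a) :
    ∃ j : P → P → P, ∀ x y z, j x y ≤ z ↔ x ≤ z ∧ y ≤ z := by
  choose s h using hs
  exact ⟨fun x y => s {x, y}, fun x y z => by rw [isLUB_le_iff (h {x, y})]; simp [upperBounds]⟩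

/-- Translation by a join is Scott continuous. -/
theorem scottContinuous_join {j : P → P → P} (hj : ∀ x y z, j x y ≤ z ↔ x ≤ z ∧ y ≤ z) (y : P) :
    ScottContinuous fun x => j x y := by
  intro d hne _ a ha
  constructor
  · rintro _ ⟨x, hx, rfl⟩
    have := (hj a y _).1 le_rfl
    exact (hj _ _ _).2 ⟨(ha.1 hx).trans this.1, this.2⟩
  · intro b hb
    obtain ⟨x, hx⟩ := hne
    refine (hj _ _ _).2 ⟨ha.2 fun z hz => ?_, ?_⟩
    · exact ((hj _ _ _).1 (hb ⟨z, hz, rfl⟩)).1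
    · exact ((hj _ _ _).1 (hb ⟨x, hx, rfl⟩)).2

/-- For compact `K` and open `U`, the set of all `x` with `x ∨ y ∈ U` for every `y ∈ K` is open. -/
theorem scottOpen_forall_join {j : P → P → P} (hj : ∀ x y z, j x y ≤ z ↔ x ≤ z ∧ y ≤ z)
    {K U : Set P} (hK : ScottCompact K) (hU : ScottOpen U) :
    ScottOpen {x | ∀ y ∈ K, j x y ∈ U} := by
  have hj1 : ∀ x y, x ≤ j x y := fun x y => ((hj x y _).1 le_rfl).1
  have hj2 : ∀ x y, y ≤ j x y := fun x y => ((hj x y _).1 le_rfl).2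
  have hjc : ∀ x y, j x y = j y x := fun x y =>
    le_antisymm ((hj _ _ _).2 ⟨hj2 _ _, hj1 _ _⟩) ((hj _ _ _).2 ⟨hj2 _ _, hj1 _ _⟩)
  have hmono : ∀ {x x'} y, x ≤ x' → j x y ≤ j x' y := fun y h =>
    (hj _ _ _).2 ⟨h.trans (hj1 _ _), hj2 _ _⟩
  refine scottOpen_iff.2 ⟨fun x x' hxx' hx y hy => hU.upper (hmono y hxx') (hx y hy),
    fun d hne hdir a ha haU => ?_⟩
  have := hne.to_subtype
  obtain ⟨⟨x, hx⟩, hKx⟩ := hK.elim (fun x : d => {y | j x.1 y ∈ U})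
    (fun x => by
      have := scottOpen_preimage (scottContinuous_join hj x.1) hU
      simpa only [Set.preimage, hjc _ x.1] using this)
    (fun x x' => by
      obtain ⟨z, hz, h1, h2⟩ := hdir _ x.2 _ x'.2
      exact ⟨⟨z, hz⟩, fun y hy => hU.upper (hmono y h1) hy, fun y hy => hU.upper (hmono y h2) hy⟩)
    (fun y hy => by
      have hop := scottOpen_preimage (scottContinuous_join hj y) hU
      obtain ⟨x, hx, hxU⟩ := (scottOpen_iff.1 hop).2 hne hdir ha (haU y hy)
      exact Set.mem_iUnion.2 ⟨⟨x, hx⟩, hxU⟩)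
  exact ⟨x, hx, fun y hy => hKx hy⟩

/-- Every complete lattice is well-filtered. -/
theorem wellFiltered_of_complete (hs : ∀ S : Set P, ∃ a, IsLUB S a) : WellFiltered P := by
  intro C hne hdir hC U hU hCU
  by_contra! hno
  obtain ⟨j, hj⟩ := exists_join hs
  have hj1 : ∀ x y, x ≤ j x y := fun x y => ((hj x y _).1 le_rfl).1
  have hj2 : ∀ x y, y ≤ j x y := fun x y => ((hj x y _).1 le_rfl).2
  obtain ⟨A, hA, hAU, hAC, hmin⟩ := exists_minimal_transversal (fun K hK => (hC K hK).1) hU hno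
  have key : ∀ K ∈ C, ∃ x ∈ K ∩ A, ∀ a ∈ A, j x a ∈ A := by
    intro K hK
    by_contra! hcon
    have := hne.to_subtype
    have hcov : K ∩ A ⊆ ⋃ L : C, {x | ∀ y ∈ L.1, j x y ∈ Aᶜ} := by
      intro x hx
      obtain ⟨a, ha, hxa⟩ := hcon x hx
      by_contra hx'
      have hB : ScottClosed ({y | j y x ∈ A} ∩ A) := by
        have := scottClosed_preimage (scottContinuous_join hj x) hA
        exact @IsClosed.inter P _ _ (Topology.scott P Set.univ) this hA
      have := hmin _ hB Set.inter_subset_right (fun L hL => by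
        by_contra hemp
        refine hx' (Set.mem_iUnion.2 ⟨⟨L, hL⟩, fun y hy hyA => hemp ⟨y, hy, ?_, ?_⟩⟩)
        · exact hA.lower ((hj _ _ _).2 ⟨hj2 _ _, hj1 _ _⟩) hyA
        · exact hA.lower (hj2 _ _) hyA) ha
      exact hxa (hA.lower ((hj _ _ _).2 ⟨hj2 _ _, hj1 _ _⟩) this.1)
    obtain ⟨⟨L, hL⟩, hKL⟩ := ((hC K hK).1.inter_closed hA).elim _
      (fun L : C => scottOpen_forall_join hj (hC _ L.2).1 hA.compl)
      (fun L L' => by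
        obtain ⟨M, hM, h1, h2⟩ := hdir _ L.2 _ L'.2
        exact ⟨⟨M, hM⟩, fun x hx y hy => hx y (h1 hy), fun x hx y hy => hx y (h2 hy)⟩) hcov
    obtain ⟨M, hM, h1, h2⟩ := hdir K hK L hL
    obtain ⟨y, hyM, hyA⟩ := hAC M hM
    exact hKL ⟨h1 hyM, hyA⟩ y (h2 hyM) (hA.lower ((hj _ _ _).2 ⟨le_rfl, le_rfl⟩) hyA)
  set G : Set P := {x | x ∈ A ∧ ∀ a ∈ A, j x a ∈ A}
  obtain ⟨g, hg⟩ := hs G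
  obtain ⟨K₀, hK₀⟩ := hne
  obtain ⟨x₀, hx₀, hx₀'⟩ := key K₀ hK₀
  have hgA : g ∈ A := (scottClosed_iff.1 hA).2 (d := G) (fun x hx => hx.1) ⟨x₀, hx₀.2, hx₀'⟩
    (by
      rintro x ⟨hx, hx'⟩ y ⟨hy, hy'⟩
      refine ⟨j x y, ⟨hx' y hy, fun a ha => hA.lower ?_ (hx' _ (hy' a ha))⟩, hj1 _ _, hj2 _ _⟩
      exact (hj _ _ _).2 ⟨(hj _ _ _).2 ⟨hj1 _ _, (hj1 _ _).trans (hj2 _ _)⟩,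
        (hj2 _ _).trans (hj2 _ _)⟩) hg
  refine hAU hgA (hCU fun K hK => ?_)
  obtain ⟨x, hx, hx'⟩ := key K hK
  exact (hC K hK).2 (hg.1 ⟨hx.2, hx'⟩) hx.1

/-- In a complete lattice the intersection of two compact saturated sets is compact. -/
theorem scottCompact_inter (hs : ∀ S : Set P, ∃ a, IsLUB S a) {K L : Set P}
    (hK : ScottCompact K) (hL : ScottCompact L) (hK' : IsUpperSet K) (hL' : IsUpperSet L) :
    ScottCompact (K ∩ L) := by
  obtain ⟨j, hj⟩ := exists_join hs
  have hj1 : ∀ x y, x ≤ j x y := fun x y => ((hj x y _).1 le_rfl).1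
  have hj2 : ∀ x y, y ≤ j x y := fun x y => ((hj x y _).1 le_rfl).2
  have hjc : ∀ x y, j x y = j y x := fun x y =>
    le_antisymm ((hj _ _ _).2 ⟨hj2 _ _, hj1 _ _⟩) ((hj _ _ _).2 ⟨hj2 _ _, hj1 _ _⟩)
  refine scottCompact_of_directed fun D hne hdir hop hc => ?_
  have := hne.to_subtype
  obtain ⟨⟨U, hU⟩, hKU⟩ := hK.elim (fun U : D => {x | ∀ y ∈ L, j x y ∈ U.1})
    (fun U => scottOpen_forall_join hj hL (hop _ U.2))
    (fun U V => by
      obtain ⟨W, hW, h1, h2⟩ := hdir _ U.2 _ V.2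
      exact ⟨⟨W, hW⟩, fun x hx y hy => h1 (hx y hy), fun x hx y hy => h2 (hx y hy)⟩)
    (fun x hx => by
      obtain ⟨⟨U, hU⟩, hLU⟩ := hL.elim (fun U : D => {y | j x y ∈ U.1})
        (fun U => by
          have := scottOpen_preimage (scottContinuous_join hj x) (hop _ U.2)
          simpa only [Set.preimage, hjc _ x] using this)
        (fun U V => by
          obtain ⟨W, hW, h1, h2⟩ := hdir _ U.2 _ V.2
          exact ⟨⟨W, hW⟩, fun y hy => h1 hy, fun y hy => h2 hy⟩)
        (fun y hy => by
          obtain ⟨U, hU, h⟩ := hc ⟨hK' (hj1 x y) hx, hL' (hj2 x y) hy⟩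
          exact Set.mem_iUnion.2 ⟨⟨U, hU⟩, h⟩)
      exact Set.mem_iUnion.2 ⟨⟨U, hU⟩, fun y hy => hLU hy⟩)
  exact ⟨U, hU, fun z hz => (hop U hU).upper ((hj _ _ _).2 ⟨le_rfl, le_rfl⟩) (hKU hz.1 z hz.2)⟩

/-- In a complete lattice any intersection of compact saturated sets is compact. -/
theorem scottCompact_sInter (hs : ∀ S : Set P, ∃ a, IsLUB S a) {S : Set (Set P)}
    (hS : ∀ K ∈ S, ScottCompact K ∧ IsUpperSet K) : ScottCompact (⋂₀ S) := by
  have hfin : ∀ F : Set (Set P), F.Finite → F ⊆ S →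
      ScottCompact (⋂₀ F) ∧ IsUpperSet (⋂₀ F) := by
    intro F hF
    refine Set.Finite.induction_on F hF ?_ ?_
    · intro _
      refine ⟨scottCompact_of_directed fun D hne hdir hop hc => ?_, by
        rw [Set.sInter_empty]; exact isUpperSet_univ⟩
      obtain ⟨b, hb⟩ := hs ∅
      have hb' : ∀ x, b ≤ x := fun x => hb.2 (by simp)
      obtain ⟨U, hU, hbU⟩ := hc (show b ∈ ⋂₀ (∅ : Set (Set P)) by simp)
      exact ⟨U, hU, fun x _ => (hop U hU).upper (hb' x) hbU⟩
    · intro K F _ _ ih hKF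
      have h1 := hS K (hKF (Set.mem_insert _ _))
      have h2 := ih ((Set.subset_insert _ _).trans hKF)
      rw [Set.sInter_insert]
      exact ⟨scottCompact_inter hs h1.1 h2.1 h1.2 h2.2, h1.2.inter h2.2⟩
  refine scottCompact_of_directed fun D hne hdir hop hc => ?_
  obtain ⟨_, ⟨F, ⟨hF, hFS⟩, rfl⟩, hFU⟩ := wellFiltered_of_complete hs
    ((fun F : Set (Set P) => ⋂₀ F) '' {F | F.Finite ∧ F ⊆ S})
    ⟨_, ∅, ⟨Set.finite_empty, Set.empty_subset _⟩, rfl⟩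
    (by
      rintro _ ⟨F, hF, rfl⟩ _ ⟨G, hG, rfl⟩
      exact ⟨_, ⟨F ∪ G, ⟨hF.1.union hG.1, Set.union_subset hF.2 hG.2⟩, rfl⟩,
        Set.sInter_subset_sInter Set.subset_union_left,
        Set.sInter_subset_sInter Set.subset_union_right⟩)
    (by
      rintro _ ⟨F, hF, rfl⟩
      exact hfin F hF.1 hF.2)
    (⋃₀ D) (scottOpen_sUnion hop) (fun x hx => hc fun K hK =>
      hx _ ⟨{K}, ⟨Set.finite_singleton K, by simpa using hK⟩, rfl⟩ K rfl)
  have := hne.to_subtype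
  obtain ⟨⟨U, hU⟩, h⟩ := (hfin F hF hFS).1.elim (fun U : D => U.1) (fun U => hop _ U.2)
    (fun U V => by
      obtain ⟨W, hW, h1, h2⟩ := hdir _ U.2 _ V.2
      exact ⟨⟨W, hW⟩, h1, h2⟩)
    (by rw [← Set.sUnion_eq_iUnion]; exact hFU)
  exact ⟨U, hU, fun x hx => h fun K hK => hx K (hFS hK)⟩

end Complete

end Scott

/-! ### The Hoare power construction -/

/-- The Hoare power construction: all Scott closed subsets (the empty set included), ordered by
inclusion. -/
@[ext]
structure Hoare (P : Type u) [PartialOrder P] where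
  carrier : Set P
  closed : ScottClosed carrier

namespace Hoare

variable {P : Type u} [PartialOrder P] {Q : Type v} [PartialOrder Q]

instance : PartialOrder (Hoare P) where
  le A B := A.carrier ⊆ B.carrier
  le_refl _ := subset_rfl
  le_trans _ _ _ h h' := h.trans h'
  le_antisymm _ _ h h' := Hoare.ext (h.antisymm h')

theorem le_def {A B : Hoare P} : A ≤ B ↔ A.carrier ⊆ B.carrier := Iff.rfl

theorem exists_isLUB (S : Set (Hoare P)) : ∃ A, IsLUB S A :=
  ⟨⟨scottClosure (⋃ A ∈ S, A.carrier), scottClosed_closure _⟩,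
    fun _ hA => (Set.subset_biUnion_of_mem (u := fun A : Hoare P => A.carrier) hA).trans
      (subset_scottClosure _),
    fun B hB => scottClosure_subset B.closed (Set.iUnion₂_subset fun _ hA => hB hA)⟩

theorem wellFiltered : WellFiltered (Hoare P) := wellFiltered_of_complete exists_isLUB

/-- `H(f)(A) = cl(f(A))`. -/
def map (f : P → Q) (A : Hoare P) : Hoare Q := ⟨scottClosure (f '' A.carrier), scottClosed_closure _⟩

theorem map_le_iff {f : P → Q} {A : Hoare P} {B : Hoare Q} :
    map f A ≤ B ↔ ∀ x ∈ A.carrier, f x ∈ B.carrier :=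
  ⟨fun h x hx => h (subset_scottClosure _ ⟨x, hx, rfl⟩),
    fun h => scottClosure_subset B.closed (by rintro _ ⟨x, hx, rfl⟩; exact h x hx)⟩

theorem mem_map {f : P → Q} {A : Hoare P} {x : P} (hx : x ∈ A.carrier) :
    f x ∈ (map f A).carrier :=
  map_le_iff.1 le_rfl x hx

theorem scottContinuous_map {f : P → Q} (hf : ScottContinuous f) : ScottContinuous (map f) := by
  intro d _ _ A hA
  constructor
  · rintro _ ⟨B, hB, rfl⟩
    exact map_le_iff.2 fun x hx => map_le_iff.1 le_rfl x (hA.1 hB hx)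
  · intro B hB
    have : A ≤ ⟨f ⁻¹' B.carrier, scottClosed_preimage hf B.closed⟩ :=
      hA.2 fun A' hA' x hx => map_le_iff.1 (hB ⟨A', hA', rfl⟩) x hx
    exact map_le_iff.2 fun x hx => this hx

/-- The unit `x ↦ ↓x`. -/
def pure (x : P) : Hoare P := ⟨Set.Iic x, scottClosed_Iic x⟩

theorem pure_le_iff {x : P} {A : Hoare P} : pure x ≤ A ↔ x ∈ A.carrier :=
  ⟨fun h => h (Set.self_mem_Iic), fun h _ hy => A.closed.lower hy h⟩

theorem scottContinuous_pure : ScottContinuous (pure : P → Hoare P) := by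
  intro d hne hdir a ha
  constructor
  · rintro _ ⟨x, hx, rfl⟩
    exact pure_le_iff.2 (ha.1 hx)
  · intro B hB
    exact pure_le_iff.2 ((scottClosed_iff.1 B.closed).2
      (fun x hx => pure_le_iff.1 (hB ⟨x, hx, rfl⟩)) hne hdir ha)

/-- The multiplication `𝒜 ↦ ⋃ 𝒜`. -/
def join (A : Hoare (Hoare P)) : Hoare P where
  carrier := {x | ∃ B ∈ A.carrier, x ∈ B.carrier}
  closed := by
    have : {x | ∃ B ∈ A.carrier, x ∈ B.carrier} = (pure : P → Hoare P) ⁻¹' A.carrier := by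
      ext x
      exact ⟨fun ⟨B, hB, hx⟩ => A.closed.lower (pure_le_iff.2 hx) hB,
        fun h => ⟨_, h, Set.self_mem_Iic⟩⟩
    rw [this]
    exact scottClosed_preimage scottContinuous_pure A.closed

theorem join_le_iff {A : Hoare (Hoare P)} {B : Hoare P} :
    join A ≤ B ↔ ∀ C ∈ A.carrier, C ≤ B :=
  ⟨fun h C hC _ hx => h ⟨C, hC, hx⟩, fun h _ ⟨C, hC, hx⟩ => h C hC hx⟩

theorem scottContinuous_join : ScottContinuous (join : Hoare (Hoare P) → Hoare P) := by
  intro d _ _ A hA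
  constructor
  · rintro _ ⟨B, hB, rfl⟩
    exact join_le_iff.2 fun C hC => join_le_iff.1 le_rfl C (hA.1 hB hC)
  · intro B hB
    have : A ≤ pure B := hA.2 fun A' hA' C hC => join_le_iff.1 (hB ⟨A', hA', rfl⟩) C hC
    exact join_le_iff.2 fun C hC => this hC

end Hoare

/-! ### The Smyth power construction -/

/-- The Smyth power construction: all nonempty Scott compact saturated subsets, ordered by reverse
inclusion. -/
@[ext]
structure Smyth (P : Type u) [PartialOrder P] where
  carrier : Set P
  nonempty : carrier.Nonempty
  compact : ScottCompact carrier
  upper : IsUpperSet carrier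

namespace Smyth

variable {P : Type u} [PartialOrder P] {Q : Type v} [PartialOrder Q]

instance : PartialOrder (Smyth P) where
  le K L := L.carrier ⊆ K.carrier
  le_refl _ := subset_rfl
  le_trans _ _ _ h h' := h'.trans h
  le_antisymm _ _ h h' := Smyth.ext (h'.antisymm h)

theorem le_def {K L : Smyth P} : K ≤ L ↔ L.carrier ⊆ K.carrier := Iff.rfl

/-- In a well-filtered poset filtered intersections of members of `Smyth P` are in `Smyth P`, and
are the directed suprema. -/
theorem exists_isLUB_inter (hP : WellFiltered P) {d : Set (Smyth P)} (hne : d.Nonempty)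
    (hdir : DirectedOn (· ≤ ·) d) :
    ∃ M : Smyth P, M.carrier = {x | ∀ K ∈ d, x ∈ K.carrier} ∧ IsLUB d M := by
  have wf : ∀ U : Set P, ScottOpen U → {x | ∀ K ∈ d, x ∈ K.carrier} ⊆ U →
      ∃ K ∈ d, K.carrier ⊆ U := by
    intro U hU h
    obtain ⟨_, ⟨K, hK, rfl⟩, hKU⟩ := hP (carrier '' d) (hne.image _)
      (by
        rintro _ ⟨K, hK, rfl⟩ _ ⟨L, hL, rfl⟩
        obtain ⟨M, hM, h1, h2⟩ := hdir K hK L hL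
        exact ⟨_, ⟨M, hM, rfl⟩, h1, h2⟩)
      (by
        rintro _ ⟨K, hK, rfl⟩
        exact ⟨K.compact, K.upper⟩) U hU (fun x hx => h fun K hK => hx _ ⟨K, hK, rfl⟩)
    exact ⟨K, hK, hKU⟩
  refine ⟨⟨{x | ∀ K ∈ d, x ∈ K.carrier}, ?_, ?_, ?_⟩, rfl, ?_, ?_⟩
  · by_contra hemp
    rw [Set.not_nonempty_iff_eq_empty] at hemp
    obtain ⟨K, hK, h⟩ := wf ∅ (@isOpen_empty P (Topology.scott P Set.univ)) hemp.subset
    obtain ⟨x, hx⟩ := K.nonempty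
    exact h hx
  · refine scottCompact_of_directed fun D hDne hD hop hc => ?_
    obtain ⟨K, hK, h⟩ := wf _ (scottOpen_sUnion hop) hc
    have := hDne.to_subtype
    obtain ⟨⟨U, hU⟩, hKU⟩ := K.compact.elim (fun U : D => U.1) (fun U => hop _ U.2)
      (fun U V => by
        obtain ⟨W, hW, h1, h2⟩ := hD _ U.2 _ V.2
        exact ⟨⟨W, hW⟩, h1, h2⟩)
      (by rw [← Set.sUnion_eq_iUnion]; exact h)
    exact ⟨U, hU, fun x hx => hKU (hx K hK)⟩
  · exact fun x y hxy hx K hK => K.upper hxy (hx K hK)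
  · exact fun K hK x hx => hx K hK
  · exact fun L hL x hx K hK => hL hK hx

theorem isLUB_carrier (hP : WellFiltered P) {d : Set (Smyth P)} (hne : d.Nonempty)
    (hdir : DirectedOn (· ≤ ·) d) {M : Smyth P} (hM : IsLUB d M) :
    M.carrier = {x | ∀ K ∈ d, x ∈ K.carrier} := by
  obtain ⟨N, hN, hN'⟩ := exists_isLUB_inter hP hne hdir
  rw [hM.unique hN', hN]

/-- If a directed supremum lies in an open set `U`, then so does a member of the family. -/
theorem exists_subset (hP : WellFiltered P) {d : Set (Smyth P)} (hne : d.Nonempty)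
    (hdir : DirectedOn (· ≤ ·) d) {M : Smyth P} (hM : IsLUB d M) {U : Set P} (hU : ScottOpen U)
    (hMU : M.carrier ⊆ U) : ∃ K ∈ d, K.carrier ⊆ U := by
  obtain ⟨_, ⟨K, hK, rfl⟩, hKU⟩ := hP (carrier '' d) (hne.image _)
    (by
      rintro _ ⟨K, hK, rfl⟩ _ ⟨L, hL, rfl⟩
      obtain ⟨M, hM, h1, h2⟩ := hdir K hK L hL
      exact ⟨_, ⟨M, hM, rfl⟩, h1, h2⟩)
    (by
      rintro _ ⟨K, hK, rfl⟩
      exact ⟨K.compact, K.upper⟩) U hU (fun x hx => hMU (by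
        rw [isLUB_carrier hP hne hdir hM]
        exact fun K hK => hx _ ⟨K, hK, rfl⟩))
  exact ⟨K, hK, hKU⟩

/-- `□U = {K | K ⊆ U}` is Scott open. -/
theorem scottOpen_box (hP : WellFiltered P) {U : Set P} (hU : ScottOpen U) :
    ScottOpen {K : Smyth P | K.carrier ⊆ U} := by
  refine scottOpen_iff.2 ⟨fun K L hKL hK => Set.Subset.trans hKL hK, fun d hne hdir M hM hMU => ?_⟩
  obtain ⟨K, hK, h⟩ := exists_subset hP hne hdir hM hU hMU
  exact ⟨K, hK, h⟩

/-- The set of all `K` that meet a given closed set is Scott closed. -/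
theorem scottClosed_meets (hP : WellFiltered P) {A : Set P} (hA : ScottClosed A) :
    ScottClosed {K : Smyth P | (A ∩ K.carrier).Nonempty} := by
  have := (scottOpen_box hP hA.compl).compl
  convert this using 1
  ext K
  simp only [Set.mem_ofPred_eq, Set.mem_compl_iff, Set.not_subset, not_not]
  exact ⟨fun ⟨x, h1, h2⟩ => ⟨x, h2, h1⟩, fun ⟨x, h1, h2⟩ => ⟨x, h2, h1⟩⟩

/-- `Q(f)(K) = ↑f(K)`. -/
def map (f : P → Q) (hf : ScottContinuous f) (K : Smyth P) : Smyth Q where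
  carrier := {y | ∃ x ∈ K.carrier, f x ≤ y}
  nonempty := K.nonempty.imp' f fun x hx => ⟨x, hx, le_rfl⟩
  compact := K.compact.up_image hf
  upper := fun _ _ h ⟨x, hx, hxy⟩ => ⟨x, hx, hxy.trans h⟩

theorem le_map_iff {f : P → Q} {hf : ScottContinuous f} {K : Smyth P} {L : Smyth Q} :
    L ≤ map f hf K ↔ ∀ x ∈ K.carrier, f x ∈ L.carrier :=
  ⟨fun h x hx => h ⟨x, hx, le_rfl⟩, fun h _ ⟨x, hx, hy⟩ => L.upper hy (h x hx)⟩

theorem scottContinuous_map (hP : WellFiltered P) {f : P → Q} (hf : ScottContinuous f) :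
    ScottContinuous (map f hf) := by
  intro d hne hdir M hM
  constructor
  · rintro _ ⟨K, hK, rfl⟩
    exact le_map_iff.2 fun x hx => ⟨x, hM.1 hK hx, le_rfl⟩
  · intro N hN y hy
    by_contra hcon
    obtain ⟨K, hK, h⟩ := exists_subset hP hne hdir hM
      (scottOpen_preimage hf (scottClosed_Iic y).compl) (fun x hx hxy => hcon ⟨x, hx, hxy⟩)
    obtain ⟨x, hx, hxy⟩ := hN ⟨K, hK, rfl⟩ hy
    exact h hx hxy

/-- The unit `x ↦ ↑x`. -/
def pure (x : P) : Smyth P where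
  carrier := Set.Ici x
  nonempty := ⟨x, Set.self_mem_Ici⟩
  compact := scottCompact_of_directed fun _ _ _ hop hc => by
    obtain ⟨U, hU, hx⟩ := hc (Set.self_mem_Ici (a := x))
    exact ⟨U, hU, fun y hy => (hop U hU).upper hy hx⟩
  upper := isUpperSet_Ici x

theorem le_pure_iff {x : P} {K : Smyth P} : K ≤ pure x ↔ x ∈ K.carrier :=
  ⟨fun h => h (Set.self_mem_Ici), fun h _ hy => K.upper hy h⟩

theorem scottContinuous_pure : ScottContinuous (pure : P → Smyth P) := by
  intro d hne hdir a ha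
  constructor
  · rintro _ ⟨x, hx, rfl⟩
    exact le_pure_iff.2 (ha.1 hx)
  · exact fun N hN y hy => ha.2 fun x hx => hN ⟨x, hx, rfl⟩ hy

/-- The union of a compact set of compact saturated sets is compact. -/
theorem scottCompact_union (hP : WellFiltered P) {K : Set (Smyth P)} (hK : ScottCompact K) :
    ScottCompact {x | ∃ L ∈ K, x ∈ L.carrier} := by
  refine scottCompact_of_directed fun D hne hdir hop hc => ?_
  have := hne.to_subtype
  obtain ⟨⟨U, hU⟩, h⟩ := hK.elim (fun U : D => {L : Smyth P | L.carrier ⊆ U.1})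
    (fun U => scottOpen_box hP (hop _ U.2))
    (fun U V => by
      obtain ⟨W, hW, h1, h2⟩ := hdir _ U.2 _ V.2
      exact ⟨⟨W, hW⟩, fun L hL => Set.Subset.trans hL h1, fun L hL => Set.Subset.trans hL h2⟩)
    (fun L hL => by
      obtain ⟨⟨U, hU⟩, h⟩ := L.compact.elim (fun U : D => U.1) (fun U => hop _ U.2)
        (fun U V => by
          obtain ⟨W, hW, h1, h2⟩ := hdir _ U.2 _ V.2
          exact ⟨⟨W, hW⟩, h1, h2⟩)
        (by
          rw [← Set.sUnion_eq_iUnion]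
          exact fun x hx => hc ⟨L, hL, hx⟩)
      exact Set.mem_iUnion.2 ⟨⟨U, hU⟩, h⟩)
  exact ⟨U, hU, fun x ⟨L, hL, hx⟩ => h hL hx⟩

/-- The multiplication `𝒦 ↦ ⋃ 𝒦`. -/
def join (hP : WellFiltered P) (K : Smyth (Smyth P)) : Smyth P where
  carrier := {x | ∃ L ∈ K.carrier, x ∈ L.carrier}
  nonempty := by
    obtain ⟨L, hL⟩ := K.nonempty
    obtain ⟨x, hx⟩ := L.nonempty
    exact ⟨x, L, hL, hx⟩
  compact := scottCompact_union hP K.compact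
  upper := fun _ _ h ⟨L, hL, hx⟩ => ⟨L, hL, L.upper h hx⟩

/-- The Smyth power construction of a well-filtered poset is well-filtered. -/
theorem wellFiltered (hP : WellFiltered P) : WellFiltered (Smyth P) := by
  intro C hne hdir hC U hU hCU
  by_contra! hno
  obtain ⟨A, hA, hAU, hAC, hmin⟩ := exists_minimal_transversal (fun K hK => (hC K hK).1) hU hno
  let k : C → Smyth P := fun K =>
    { carrier := {x | ∃ L ∈ K.1 ∩ A, x ∈ L.carrier}
      nonempty := by
        obtain ⟨L, hL⟩ := hAC _ K.2
        obtain ⟨x, hx⟩ := L.nonempty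
        exact ⟨x, L, hL, hx⟩
      compact := scottCompact_union hP ((hC _ K.2).1.inter_closed hA)
      upper := fun _ _ h ⟨L, hL, hx⟩ => ⟨L, hL, L.upper h hx⟩ }
  have := hne.to_subtype
  have kdir : DirectedOn (· ≤ ·) (Set.range k) := by
    rintro _ ⟨K, rfl⟩ _ ⟨L, rfl⟩
    obtain ⟨M, hM, h1, h2⟩ := hdir _ K.2 _ L.2
    exact ⟨k ⟨M, hM⟩, ⟨_, rfl⟩, fun x ⟨N, hN, hx⟩ => ⟨N, ⟨h1 hN.1, hN.2⟩, hx⟩,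
      fun x ⟨N, hN, hx⟩ => ⟨N, ⟨h2 hN.1, hN.2⟩, hx⟩⟩
  obtain ⟨M, hM, hlub⟩ := exists_isLUB_inter hP (Set.range_nonempty k) kdir
  have hMA : M ∈ A := (scottClosed_iff.1 hA).2 (d := Set.range k)
    (by
      rintro _ ⟨K, rfl⟩
      obtain ⟨L, hL⟩ := hAC _ K.2
      exact hA.lower (show k K ≤ L from fun x hx => ⟨L, hL, hx⟩) hL.2)
    (Set.range_nonempty k) kdir hlub
  have hall : ∀ L ∈ A, L ≤ M := by
    intro L hL x hx
    have := hmin (A ∩ Set.Iic (pure x))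
      (@IsClosed.inter _ _ _ (Topology.scott (Smyth P) Set.univ) hA (scottClosed_Iic _))
      Set.inter_subset_left (fun K hK => by
        rw [hM] at hx
        obtain ⟨N, hN, hxN⟩ := hx (k ⟨K, hK⟩) ⟨_, rfl⟩
        exact ⟨N, hN.1, hN.2, le_pure_iff.2 hxN⟩) hL
    exact le_pure_iff.1 this.2
  refine hAU hMA (hCU fun K hK => ?_)
  obtain ⟨L, hL, hLA⟩ := hAC K hK
  exact (hC K hK).2 (hall L hLA) hL

theorem scottContinuous_join (hP : WellFiltered P) :
    ScottContinuous (join hP : Smyth (Smyth P) → Smyth P) := by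
  intro d hne hdir M hM
  constructor
  · rintro _ ⟨K, hK, rfl⟩
    exact fun x ⟨L, hL, hx⟩ => ⟨L, hM.1 hK hL, hx⟩
  · intro N hN x hx
    by_contra hcon
    obtain ⟨K, hK, h⟩ := exists_subset (wellFiltered hP) hne hdir hM
      (scottClosed_Iic (pure x)).compl
      (fun L hL hLx => hcon ⟨L, hL, le_pure_iff.1 hLx⟩)
    obtain ⟨L, hL, hxL⟩ := hN ⟨K, hK, rfl⟩ hx
    exact h hL (le_pure_iff.2 hxL)

end Smyth

/-! ### The category of well-filtered dcpos -/

/-- A well-filtered dcpo. -/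
structure WF where
  carrier : Type u
  [str : PartialOrder carrier]
  exists_isLUB : ∀ d : Set carrier, d.Nonempty → DirectedOn (· ≤ ·) d → ∃ a, IsLUB d a
  wellFiltered : WellFiltered carrier

namespace WF

instance : CoeSort WF.{u} (Type u) := ⟨WF.carrier⟩

instance (L : WF.{u}) : PartialOrder L := L.str

/-- Morphisms of well-filtered dcpos: Scott continuous maps. -/
@[ext]
structure Hom (L M : WF.{u}) where
  toFun : L → M
  continuous : ScottContinuous toFun

instance : Category WF.{u} where
  Hom := Hom
  id L := ⟨id, ScottContinuous.id⟩
  comp f g := ⟨g.toFun ∘ f.toFun, f.continuous.comp g.continuous⟩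

/-- The underlying map of a morphism. -/
def fn {L M : WF.{u}} (f : L ⟶ M) : L → M := Hom.toFun f

theorem scottContinuous_fn {L M : WF.{u}} (f : L ⟶ M) : ScottContinuous (fn f) := Hom.continuous f

theorem monotone_fn {L M : WF.{u}} (f : L ⟶ M) : Monotone (fn f) := (scottContinuous_fn f).monotone

/-- A Scott continuous map as a morphism. -/
def ofFn {L M : WF.{u}} (f : L → M) (hf : ScottContinuous f) : L ⟶ M := Hom.mk f hf

theorem hom_ext {L M : WF.{u}} {f g : L ⟶ M} (h : ∀ x, fn f x = fn g x) : f = g :=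
  Hom.ext (funext h)

/-- The well-filtered dcpo of all Scott closed subsets. -/
def hoare (L : WF.{u}) : WF.{u} where
  carrier := Hoare L
  exists_isLUB d _ _ := Hoare.exists_isLUB d
  wellFiltered := Hoare.wellFiltered

/-- The well-filtered dcpo of all nonempty Scott compact saturated subsets. -/
def smyth (L : WF.{u}) : WF.{u} where
  carrier := Smyth L
  exists_isLUB d hne hdir := by
    obtain ⟨M, _, hM⟩ := Smyth.exists_isLUB_inter L.wellFiltered hne hdir
    exact ⟨M, hM⟩
  wellFiltered := Smyth.wellFiltered L.wellFiltered

end WF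

/-! ### The Hoare and Smyth power monads -/

/-- The endofunctor `H` of `WF`. -/
def hoareFunctor : WF.{u} ⥤ WF.{u} where
  obj := WF.hoare
  map f := WF.ofFn (Hoare.map (WF.fn f)) (Hoare.scottContinuous_map (WF.scottContinuous_fn f))
  map_id L := WF.hom_ext fun (A : Hoare L) => le_antisymm
    (Hoare.map_le_iff.2 fun _ hx => hx) (fun x hx => Hoare.mem_map hx)
  map_comp f g := WF.hom_ext fun (A : Hoare _) => le_antisymm
    (Hoare.map_le_iff.2 fun x hx => Hoare.mem_map (Hoare.mem_map hx))
    (Hoare.map_le_iff.2 fun x hx => by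
      have : Hoare.map (WF.fn f) A ≤ ⟨WF.fn g ⁻¹' (Hoare.map (WF.fn g ∘ WF.fn f) A).carrier,
          scottClosed_preimage (WF.scottContinuous_fn g) (Hoare.closed _)⟩ :=
        Hoare.map_le_iff.2 fun y hy => Hoare.mem_map (f := WF.fn g ∘ WF.fn f) hy
      exact this hx)

/-- The endofunctor `Q` of `WF`. -/
def smythFunctor : WF.{u} ⥤ WF.{u} where
  obj := WF.smyth
  map {L _} f := WF.ofFn (Smyth.map (WF.fn f) (WF.scottContinuous_fn f))
    (Smyth.scottContinuous_map L.wellFiltered (WF.scottContinuous_fn f))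
  map_id L := WF.hom_ext fun (K : Smyth L) => le_antisymm
    (fun x hx => ⟨x, hx, le_rfl⟩) (fun _ ⟨_, hx, hxy⟩ => K.upper hxy hx)
  map_comp f g := WF.hom_ext fun (_ : Smyth _) => le_antisymm
    (fun _ ⟨_, ⟨x, hx, hxy⟩, hyz⟩ => ⟨x, hx, (WF.monotone_fn g hxy).trans hyz⟩)
    (fun _ ⟨x, hx, hxz⟩ => ⟨WF.fn f x, ⟨x, hx, le_rfl⟩, hxz⟩)

/-- The unit `η(x) = ↓x` of `H`. -/
def hoareUnit : 𝟭 WF.{u} ⟶ hoareFunctor where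
  app L := WF.ofFn (L := L) (M := WF.hoare L) Hoare.pure Hoare.scottContinuous_pure
  naturality L _ f := WF.hom_ext fun (_ : L) => le_antisymm
    (Hoare.pure_le_iff.2 (Hoare.mem_map (f := WF.fn f) (Set.self_mem_Iic)))
    (Hoare.map_le_iff.2 fun _ hy => WF.monotone_fn f hy)

/-- The multiplication `μ(𝒜) = ⋃ 𝒜` of `H`. -/
def hoareMul : hoareFunctor.{u} ⋙ hoareFunctor.{u} ⟶ hoareFunctor.{u} where
  app L := WF.ofFn (L := WF.hoare (WF.hoare L)) (M := WF.hoare L) Hoare.join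
    Hoare.scottContinuous_join
  naturality L _ f := WF.hom_ext fun (A : Hoare (Hoare L)) => le_antisymm
    (Hoare.join_le_iff.2 fun C hC => by
      have : Hoare.map (Hoare.map (WF.fn f)) A ≤
          Hoare.pure (Hoare.map (WF.fn f) (Hoare.join A)) :=
        Hoare.map_le_iff.2 fun B hB => Hoare.map_le_iff.2 fun x hx => Hoare.mem_map ⟨B, hB, hx⟩
      exact this hC)
    (Hoare.map_le_iff.2 fun x ⟨B, hB, hx⟩ =>
      ⟨Hoare.map (WF.fn f) B, Hoare.mem_map hB, Hoare.mem_map hx⟩)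

/-- The unit `θ(x) = ↑x` of `Q`. -/
def smythUnit : 𝟭 WF.{u} ⟶ smythFunctor where
  app L := WF.ofFn (L := L) (M := WF.smyth L) Smyth.pure Smyth.scottContinuous_pure
  naturality L _ f := WF.hom_ext fun (x : L) => le_antisymm
    (fun _ ⟨_, hy, hyz⟩ => (WF.monotone_fn f hy).trans hyz)
    (fun _ hy => ⟨x, Set.self_mem_Ici, hy⟩)

/-- The multiplication `ι(𝒦) = ⋃ 𝒦` of `Q`. -/
def smythMul : smythFunctor.{u} ⋙ smythFunctor.{u} ⟶ smythFunctor.{u} where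
  app L := WF.ofFn (L := WF.smyth (WF.smyth L)) (M := WF.smyth L)
    (Smyth.join L.wellFiltered) (Smyth.scottContinuous_join _)
  naturality L _ f := WF.hom_ext fun (K : Smyth (Smyth L)) => le_antisymm
    (fun _ ⟨x, ⟨B, hB, hx⟩, hxy⟩ =>
      ⟨Smyth.map (WF.fn f) (WF.scottContinuous_fn f) B, ⟨B, hB, le_rfl⟩, x, hx, hxy⟩)
    (fun _ ⟨_, ⟨B, hB, hBC⟩, hy⟩ => by
      obtain ⟨x, hx, hxy⟩ := hBC hy
      exact ⟨x, ⟨B, hB, hx⟩, hxy⟩)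

/-- The Hoare power monad `H`. -/
def hoareMonad : Monad WF.{u} where
  toFunctor := hoareFunctor
  η := hoareUnit
  μ := hoareMul
  assoc L := WF.hom_ext fun (A : Hoare (Hoare (Hoare L))) => le_antisymm
    (Hoare.join_le_iff.2 fun C hC => by
      have : Hoare.map Hoare.join A ≤ Hoare.pure (Hoare.join (Hoare.join A)) :=
        Hoare.map_le_iff.2 fun B hB => Hoare.join_le_iff.2 fun D hD x hx => ⟨D, ⟨B, hB, hD⟩, hx⟩
      exact this hC)
    (fun x hx => by
      obtain ⟨D, ⟨B, hB, hD⟩, hx⟩ := (hx : ∃ D, (∃ B, B ∈ A.carrier ∧ D ∈ B.carrier) ∧ x ∈ D.carrier)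
      exact ⟨Hoare.join B, Hoare.mem_map hB, D, hD, hx⟩)
  left_unit L := WF.hom_ext fun (A : Hoare L) => le_antisymm
    (Hoare.join_le_iff.2 fun _ hC => hC) (fun x hx => ⟨A, Set.self_mem_Iic, hx⟩)
  right_unit L := WF.hom_ext fun (A : Hoare L) => le_antisymm
    (Hoare.join_le_iff.2 fun C hC => by
      have : Hoare.map Hoare.pure A ≤ Hoare.pure A :=
        Hoare.map_le_iff.2 fun x hx => Hoare.pure_le_iff.2 hx
      exact this hC)
    (fun x hx => ⟨Hoare.pure x, Hoare.mem_map hx, Set.self_mem_Iic⟩)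

/-- The Smyth power monad `Q`. -/
def smythMonad : Monad WF.{u} where
  toFunctor := smythFunctor
  η := smythUnit
  μ := smythMul
  assoc L := WF.hom_ext fun (K : Smyth (Smyth (Smyth L))) => le_antisymm
    (fun x hx => by
      obtain ⟨D, ⟨B, hB, hD⟩, hx⟩ := (hx : ∃ D, (∃ B, B ∈ K.carrier ∧ D ∈ B.carrier) ∧ x ∈ D.carrier)
      exact ⟨Smyth.join L.wellFiltered B, ⟨B, hB, le_rfl⟩, D, hD, hx⟩)
    (fun x hx => by
      obtain ⟨_, ⟨B, hB, hBC⟩, hx⟩ := hx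
      obtain ⟨D, hD, hx⟩ := hBC hx
      exact ⟨D, ⟨B, hB, hD⟩, hx⟩)
  left_unit L := WF.hom_ext fun (K : Smyth L) => le_antisymm
    (fun x hx => ⟨K, Set.self_mem_Ici, hx⟩) (fun x ⟨_, hC, hx⟩ => hC hx)
  right_unit L := WF.hom_ext fun (K : Smyth L) => le_antisymm
    (fun x hx => ⟨Smyth.pure x, ⟨x, hx, le_rfl⟩, Set.self_mem_Ici⟩)
    (fun _ ⟨_, ⟨x, hx, hxC⟩, hy⟩ => K.upper (hxC hy) hx)

/-! ### Distributive laws and composite monads -/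

section Distributive

variable {C : Type v} [Category.{w} C]

/-- A distributive law (in the sense of Beck) of the monad `S` over the monad `T`: a natural
transformation `TS ⟶ ST` compatible with the units and the multiplications. (Mathlib writes
composition of functors in diagrammatic order, so `TS` is `S ⋙ T`.) -/
structure DistributiveLaw (S T : Monad C) where
  law : S.toFunctor ⋙ T.toFunctor ⟶ T.toFunctor ⋙ S.toFunctor
  map_unit : ∀ X, T.map (S.η.app X) ≫ law.app X = S.η.app (T.obj X)
  unit_map : ∀ X, T.η.app (S.obj X) ≫ law.app X = S.map (T.η.app X)
  map_mul : ∀ X, T.map (S.μ.app X) ≫ law.app X =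
    law.app (S.obj X) ≫ S.map (law.app X) ≫ S.μ.app (T.obj X)
  mul_map : ∀ X, T.μ.app (S.obj X) ≫ law.app X =
    T.map (law.app X) ≫ law.app (T.obj X) ≫ S.map (T.μ.app X)

theorem DistributiveLaw.naturality {S T : Monad C} (l : DistributiveLaw S T) {X Y : C}
    (f : X ⟶ Y) : T.map (S.map f) ≫ l.law.app Y = l.law.app X ≫ S.map (T.map f) :=
  l.law.naturality f

/-- The composite monad `ST` that a distributive law `l : TS ⟶ ST` defines: its unit is
`η^S_T ∘ η^T`, its multiplication is `S μ^T ∘ μ^S_{TT} ∘ S l_T : STST ⟶ SSTT ⟶ STT ⟶ ST`. -/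
def DistributiveLaw.composite {S T : Monad C} (l : DistributiveLaw S T) : Monad C where
  toFunctor := T.toFunctor ⋙ S.toFunctor
  η :=
    { app := fun X => T.η.app X ≫ S.η.app (T.obj X)
      naturality := fun X Y f => by
        change f ≫ T.η.app Y ≫ S.η.app (T.obj Y) =
          (T.η.app X ≫ S.η.app (T.obj X)) ≫ S.map (T.map f)
        rw [Category.assoc, ← S.unit_naturality, ← Category.assoc, T.unit_naturality,
          Category.assoc] }
  μ :=
    { app := fun X => S.map (l.law.app (T.obj X)) ≫ S.μ.app (T.obj (T.obj X)) ≫ S.map (T.μ.app X)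
      naturality := fun X Y f => by
        have h1 : S.map (T.map (S.map (T.map f))) ≫ S.map (l.law.app (T.obj Y)) =
            S.map (l.law.app (T.obj X)) ≫ S.map (S.map (T.map (T.map f))) := by
          rw [← S.map_comp, l.naturality, S.map_comp]
        have h2 : S.map (T.map (T.map f)) ≫ S.map (T.μ.app Y) =
            S.map (T.μ.app X) ≫ S.map (T.map f) := by
          rw [← S.map_comp, T.mu_naturality, S.map_comp]
        simp only [Functor.comp_map, Category.assoc]
        rw [← Category.assoc, h1, Category.assoc, S.mu_naturality_assoc, h2] }
  assoc X := by
    have h1 : T.map (S.map (l.law.app (T.obj X)) ≫ S.μ.app (T.obj (T.obj X)) ≫ S.map (T.μ.app X)) ≫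
        l.law.app (T.obj X) = l.law.app (T.obj (S.obj (T.obj X))) ≫
          S.map (T.map (l.law.app (T.obj X))) ≫ S.map (l.law.app (T.obj (T.obj X))) ≫
          S.μ.app (T.obj (T.obj (T.obj X))) ≫ S.map (T.map (T.μ.app X)) := by
      rw [T.map_comp, T.map_comp, Category.assoc, Category.assoc, l.naturality,
        ← Category.assoc (T.map (S.μ.app _)), l.map_mul]
      simp only [Category.assoc]
      have h0 : T.map (S.map (l.law.app (T.obj X))) ≫ l.law.app (S.obj (T.obj (T.obj X))) =
          l.law.app (T.obj (S.obj (T.obj X))) ≫ S.map (T.map (l.law.app (T.obj X))) :=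
        l.naturality _
      rw [← Category.assoc, h0, Category.assoc]
    have h2 : S.map (T.μ.app (S.obj (T.obj X))) ≫ S.map (l.law.app (T.obj X)) =
        S.map (T.map (l.law.app (T.obj X))) ≫ S.map (l.law.app (T.obj (T.obj X))) ≫
          S.map (S.map (T.μ.app (T.obj X))) := by
      rw [← S.map_comp, l.mul_map, S.map_comp, S.map_comp]
    have h3 : S.map (T.map (T.μ.app X)) ≫ S.map (T.μ.app X) =
        S.map (T.μ.app (T.obj X)) ≫ S.map (T.μ.app X) := by
      rw [← S.map_comp, T.assoc, S.map_comp]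
    have h4 : S.map (T.map (S.map (l.law.app (T.obj X)) ≫ S.μ.app (T.obj (T.obj X)) ≫
        S.map (T.μ.app X))) ≫ S.map (l.law.app (T.obj X)) =
        S.map (l.law.app (T.obj (S.obj (T.obj X)))) ≫
          S.map (S.map (T.map (l.law.app (T.obj X)))) ≫
          S.map (S.map (l.law.app (T.obj (T.obj X)))) ≫
          S.map (S.μ.app (T.obj (T.obj (T.obj X)))) ≫ S.map (S.map (T.map (T.μ.app X))) := by
      rw [← S.map_comp, h1]
      simp only [S.map_comp]
    change S.map (T.map _) ≫ S.map _ ≫ S.μ.app _ ≫ S.map _ =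
      (S.map _ ≫ S.μ.app _ ≫ S.map _) ≫ S.map _ ≫ S.μ.app _ ≫ S.map _
    rw [← Category.assoc, h4]
    simp only [Category.assoc]
    rw [S.mu_naturality_assoc, h3]
    have h5 : S.map (T.μ.app (S.obj (T.obj X))) ≫ S.map (l.law.app (T.obj X)) ≫
        S.μ.app (T.obj (T.obj X)) ≫ S.map (T.μ.app X) =
        S.map (T.map (l.law.app (T.obj X))) ≫ S.map (l.law.app (T.obj (T.obj X))) ≫
          S.μ.app (T.obj (T.obj (T.obj X))) ≫ S.map (T.μ.app (T.obj X)) ≫ S.map (T.μ.app X) := by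
      rw [← Category.assoc, h2]
      simp only [Category.assoc]
      rw [S.mu_naturality_assoc]
    change _ = S.map (l.law.app (T.obj (S.obj (T.obj X)))) ≫ S.μ.app (T.obj (T.obj (S.obj (T.obj X)))) ≫
        S.map (T.μ.app (S.obj (T.obj X))) ≫ S.map (l.law.app (T.obj X)) ≫
        S.μ.app (T.obj (T.obj X)) ≫ S.map (T.μ.app X)
    have e1 : S.μ.app (T.obj (T.obj (S.obj (T.obj X)))) ≫ S.map (T.map (l.law.app (T.obj X))) =
        S.map (S.map (T.map (l.law.app (T.obj X)))) ≫
          S.μ.app (T.obj (S.obj (T.obj (T.obj X)))) :=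
      (S.mu_naturality _ _).symm
    have e2 : S.μ.app (T.obj (S.obj (T.obj (T.obj X)))) ≫ S.map (l.law.app (T.obj (T.obj X))) =
        S.map (S.map (l.law.app (T.obj (T.obj X)))) ≫
          S.μ.app (S.obj (T.obj (T.obj (T.obj X)))) :=
      (S.mu_naturality _ _).symm
    rw [h5, reassoc_of% e1, reassoc_of% e2, reassoc_of% (S.assoc (T.obj (T.obj (T.obj X))))]
  left_unit X := by
    change (T.η.app (S.obj (T.obj X)) ≫ S.η.app (T.obj (S.obj (T.obj X)))) ≫
      S.map (l.law.app (T.obj X)) ≫ S.μ.app (T.obj (T.obj X)) ≫ S.map (T.μ.app X) =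
      𝟙 (S.obj (T.obj X))
    rw [Category.assoc, ← S.unit_naturality_assoc, ← Category.assoc, l.unit_map]
    erw [S.left_unit_assoc]
    rw [← S.map_comp, T.left_unit, S.map_id]
    rfl
  right_unit X := by
    change S.map (T.map (T.η.app X ≫ S.η.app (T.obj X))) ≫
      S.map (l.law.app (T.obj X)) ≫ S.μ.app (T.obj (T.obj X)) ≫ S.map (T.μ.app X) =
      𝟙 (S.obj (T.obj X))
    rw [← Category.assoc, ← S.map_comp, T.map_comp, Category.assoc, l.map_unit, S.map_comp,
      Category.assoc, S.right_unit_assoc, ← S.map_comp, T.right_unit, S.map_id]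
    rfl

end Distributive

/-! ### The distributive law of `Q` over `H` -/

section Phi

variable {P : Type u} [PartialOrder P]

theorem scottCompact_meets (K : Smyth P) :
    ScottCompact {A : Hoare P | (A.carrier ∩ K.carrier).Nonempty} := by
  have := K.compact.up_image (Hoare.scottContinuous_pure (P := P))
  convert this using 1
  ext A
  exact ⟨fun ⟨x, h1, h2⟩ => ⟨x, h2, Hoare.pure_le_iff.2 h1⟩,
    fun ⟨x, h1, h2⟩ => ⟨x, Hoare.pure_le_iff.1 h2, h1⟩⟩

/-- `φ(𝒜) = {A | A ∩ K ≠ ∅ for all K ∈ 𝒜}`. -/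
def phiFun (𝒜 : Hoare (Smyth P)) : Smyth (Hoare P) where
  carrier := {A | ∀ K ∈ 𝒜.carrier, (A.carrier ∩ K.carrier).Nonempty}
  nonempty := ⟨⟨Set.univ, @isClosed_univ P (Topology.scott P Set.univ)⟩, fun K _ => by
    rw [Set.univ_inter]; exact K.nonempty⟩
  compact := by
    have := scottCompact_sInter (Hoare.exists_isLUB (P := P))
      (S := (fun K : Smyth P => {A : Hoare P | (A.carrier ∩ K.carrier).Nonempty}) '' 𝒜.carrier)
      (by
        rintro _ ⟨K, _, rfl⟩
        exact ⟨scottCompact_meets K, fun A B hAB hA => hA.mono (Set.inter_subset_inter_left _ hAB)⟩)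
    convert this using 1
    ext A
    simp
  upper := fun _ _ hAB hA K hK => (hA K hK).mono (Set.inter_subset_inter_left _ hAB)

/-- A closed set that meets all members of a set of compact sets meets all members of its
closure. -/
theorem mem_phiFun (hP : WellFiltered P) {A : Hoare P} {𝒜 : Hoare (Smyth P)} :
    A ∈ (phiFun 𝒜).carrier ↔ 𝒜 ≤ ⟨_, Smyth.scottClosed_meets hP A.closed⟩ := Iff.rfl

theorem scottContinuous_phiFun (hP : WellFiltered P) :
    ScottContinuous (phiFun : Hoare (Smyth P) → Smyth (Hoare P)) := by
  intro d _ _ M hM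
  constructor
  · rintro _ ⟨B, hB, rfl⟩
    exact fun A hA K hK => hA K (hM.1 hB hK)
  · intro N hN A hA
    exact (mem_phiFun hP).2 (hM.2 fun B hB => (mem_phiFun hP).1 (hN ⟨B, hB, rfl⟩ hA))

end Phi

/-- The natural transformation `φ : HQ ⟶ QH`. -/
def phiTrans : smythFunctor.{u} ⋙ hoareFunctor.{u} ⟶ hoareFunctor.{u} ⋙ smythFunctor.{u} where
  app L := WF.ofFn (L := WF.hoare (WF.smyth L)) (M := WF.smyth (WF.hoare L)) phiFun
    (scottContinuous_phiFun L.wellFiltered)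
  naturality L M f := WF.hom_ext fun (𝒜 : Hoare (Smyth L)) => le_antisymm
    (by
      rintro B ⟨A, hA, hAB⟩
      refine (mem_phiFun M.wellFiltered).2 (Hoare.map_le_iff.2 fun K hK => ?_)
      obtain ⟨x, hxA, hxK⟩ := hA K hK
      exact ⟨WF.fn f x, hAB (Hoare.mem_map hxA), x, hxK, le_rfl⟩)
    (by
      intro B hB
      refine ⟨⟨WF.fn f ⁻¹' B.carrier,
        scottClosed_preimage (WF.scottContinuous_fn f) B.closed⟩, fun K hK => ?_,
        Hoare.map_le_iff.2 fun x hx => hx⟩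
      obtain ⟨y, hyB, x, hxK, hxy⟩ := hB _ (Hoare.mem_map
        (f := Smyth.map (WF.fn f) (WF.scottContinuous_fn f)) hK)
      exact ⟨x, B.closed.lower hxy hyB, hxK⟩)

/-- The distributive law `φ : HQ ⟶ QH` of `Q` over `H`. -/
def phi : DistributiveLaw smythMonad.{u} hoareMonad.{u} where
  law := phiTrans
  map_unit L := WF.hom_ext fun (A : Hoare L) => le_antisymm
    (fun B hB => (mem_phiFun L.wellFiltered).2 (Hoare.map_le_iff.2 fun x hx =>
      ⟨x, hB hx, Set.self_mem_Ici⟩))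
    (by
      intro B hB x hx
      obtain ⟨y, hyB, hxy⟩ := hB _ (Hoare.mem_map (f := Smyth.pure) hx)
      exact B.closed.lower hxy hyB)
  unit_map L := WF.hom_ext fun (K : Smyth L) => le_antisymm
    (by
      rintro B ⟨x, hx, hxB⟩ K' hK'
      exact ⟨x, Hoare.pure_le_iff.1 hxB, hK' hx⟩)
    (by
      intro B hB
      obtain ⟨x, hxB, hxK⟩ := hB K Set.self_mem_Iic
      exact ⟨x, hxK, Hoare.pure_le_iff.2 hxB⟩)
  map_mul L := WF.hom_ext fun (𝒜 : Hoare (Smyth (Smyth L))) => le_antisymm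
    (by
      rintro A ⟨_, ⟨ℬ, hℬ, hφ⟩, hA⟩
      refine (mem_phiFun L.wellFiltered).2 (Hoare.map_le_iff.2 fun K hK => ?_)
      obtain ⟨M, hM, hMK⟩ := hℬ K hK
      obtain ⟨x, hxA, hxM⟩ := hφ hA M hM
      exact ⟨x, hxA, M, hMK, hxM⟩)
    (by
      intro A hA
      refine ⟨phiFun ⟨_, Smyth.scottClosed_meets L.wellFiltered A.closed⟩,
        ⟨⟨_, Smyth.scottClosed_meets L.wellFiltered A.closed⟩, fun K hK => ?_, le_rfl⟩,
        fun M hM => hM⟩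
      obtain ⟨x, hxA, M, hM, hxM⟩ := hA _ (Hoare.mem_map (f := Smyth.join L.wellFiltered) hK)
      exact ⟨M, ⟨x, hxA, hxM⟩, hM⟩)
  mul_map L := WF.hom_ext fun (𝒜 : Hoare (Hoare (Smyth L))) => le_antisymm
    (by
      rintro B ⟨𝒞, h𝒞, hB⟩ K ⟨ℬ, hℬ, hK⟩
      obtain ⟨A, hA, hAφ⟩ := h𝒞 _ (Hoare.mem_map (f := phiFun) hℬ)
      obtain ⟨x, hxA, hxK⟩ := hAφ K hK
      exact ⟨x, hB ⟨A, hA, hxA⟩, hxK⟩)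
    (by
      intro A hA
      refine ⟨Hoare.pure A, (mem_phiFun (Hoare.wellFiltered)).2 (Hoare.map_le_iff.2
        fun ℬ hℬ => ⟨A, Set.self_mem_Iic, fun K hK => hA K ⟨ℬ, hℬ, hK⟩⟩),
        Hoare.join_le_iff.2 fun C hC => hC⟩)

/-- The composite monad `QH` on `WF` given by the distributive law `φ`. -/
def QH : Monad WF.{u} := phi.composite

/-! ### Frames and their homomorphisms -/

/-- The order of the frame structure `F` on `P` is the given order of `P`. -/
def FrameCompatible {P : Type u} [inst : PartialOrder P] (F : Order.Frame P) : Prop :=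
  ∀ x y : P, F.le x y ↔ inst.le x y

/-- A poset is a frame: its order is that of a complete lattice in which binary infima distribute
over arbitrary suprema. -/
def IsFrame (P : Type u) [PartialOrder P] : Prop :=
  ∃ F : Order.Frame P, FrameCompatible F

/-- The map `f` preserves arbitrary suprema and the infima of nonempty finite sets. -/
structure PreservesSupsAndFiniteInfs {P : Type u} {Q : Type v} [PartialOrder P] [PartialOrder Q]
    (f : P → Q) : Prop where
  isLUB_image : ∀ (S : Set P) (a : P), IsLUB S a → IsLUB (f '' S) (f a)
  isGLB_image : ∀ S : Set P, S.Finite → S.Nonempty → ∀ a : P, IsGLB S a → IsGLB (f '' S) (f a)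

/-- The map `f` is the underlying map of a morphism of Mathlib's category of frames, that is, of a
`FrameHom` (which in addition preserves the greatest element). -/
def IsFrmMorphism {P : Type u} {Q : Type v} [PartialOrder P] [PartialOrder Q] (f : P → Q) : Prop :=
  ∃ (F : Order.Frame P) (G : Order.Frame Q), FrameCompatible F ∧ FrameCompatible G ∧
    ∃ g : FrameHom P Q, ∀ x : P, g x = f x

end WFPower

/-!
The unit law of a `QH`-algebra `α : QH(L) → L` alone forces `α(↑A) = ⋁ A` for every closed `A`,
and `α(Qη(K)) = ⋀ K` for every nonempty compact saturated `K`: the algebra map is monotone, and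
`A` lies between the sets `↓x`, `x ∈ A`, and `↓b`, `b` an upper bound of `A` (dually for `K`). So
`L` is a complete lattice. The associativity law, evaluated at two kinds of elements of `QHQH(L)`,
gives

* `α(𝒦) = ⋀ {⋁ A | A ∈ 𝒦}` (`isGLB_structureMap`), so that the order of `L` determines `α`;
* `⋁ {⋀ K | K ∈ 𝒜} = α(φ(𝒜))` (`isLUB_structureMap_phiFun`), that is, the law of
  compatibility of the induced algebras of `H` and `Q` with the distributive law.

If `𝒜` is generated by the sets `↑{x, s}`, `s ∈ S`, then a closed set belongs to `φ(𝒜)` if and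
only if it contains `x` or includes `S`. The two equations then say that
`⋁ {x ∧ s | s ∈ S} = x ∧ ⋁ S` (`le_of_forall_lowerBounds_le`), so that the carrier of every
`QH`-algebra is a frame.

A homomorphism commutes with the structure maps, hence with suprema of closed sets and infima of
compact saturated sets, in particular of the upper sets generated by nonempty finite sets.
-/

namespace WFPower

/-! ### Frames presented by suprema -/

section Frame

variable {P : Type u} [inst : PartialOrder P] {Q : Type v} [PartialOrder Q]

/-- A poset with all suprema is a frame if `x ∧ ⋁ S ≤ ⋁ {x ∧ s | s ∈ S}`; the inequality is
expressed by lower bounds of `{x, ⋁ S}` and of the pairs `{x, s}`. -/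
theorem isFrame_of_isLUB (hs : ∀ S : Set P, ∃ a, IsLUB S a)
    (hd : ∀ (x : P) (S : Set P) (a : P), IsLUB S a → ∀ b c : P, c ≤ x → c ≤ a →
      (∀ s ∈ S, ∀ m, m ≤ x → m ≤ s → m ≤ b) → c ≤ b) : IsFrame P := by
  choose s h using hs
  let : SupSet P := ⟨s⟩
  let : CompleteLattice P := completeLatticeOfSup P h
  refine ⟨Order.Frame.ofMinimalAxioms ⟨fun x S => ?_⟩, fun _ _ => Iff.rfl⟩
  refine hd x S (sSup S) (h S) _ _ inf_le_left inf_le_right fun s hs m hmx hms => ?_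
  exact (le_inf hmx hms).trans (le_iSup₂_of_le s hs le_rfl)

theorem FrameCompatible.toPartialOrder_eq {F : Order.Frame P} (h : FrameCompatible F) :
    F.toPartialOrder = inst :=
  PartialOrder.ext h

theorem FrameCompatible.isTop_iff {F : Order.Frame P} (h : FrameCompatible F) {a : P} :
    IsTop a ↔ a = F.top := by
  obtain rfl := h.toPartialOrder_eq
  exact isTop_iff_eq_top

/-- Between frames, a map that preserves suprema and nonempty finite infima is a frame
homomorphism if and only if it preserves the greatest element. -/
theorem PreservesSupsAndFiniteInfs.isFrmMorphism_iff {f : P → Q}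
    (hf : PreservesSupsAndFiniteInfs f) (hP : IsFrame P) (hQ : IsFrame Q) :
    IsFrmMorphism f ↔ ∀ a, IsTop a → IsTop (f a) := by
  constructor
  · rintro ⟨F, G, hF, hG, g, hg⟩ a ha
    rw [hF.isTop_iff] at ha
    rw [hG.isTop_iff, ← hg, ha]
    exact map_top g
  · intro htop
    obtain ⟨F, hF⟩ := hP
    obtain ⟨G, hG⟩ := hQ
    refine ⟨F, G, hF, hG, ?_⟩
    obtain rfl := hF.toPartialOrder_eq
    obtain rfl := hG.toPartialOrder_eq
    refine ⟨⟨⟨⟨f, fun a b => ?_⟩, isTop_iff_eq_top.1 (htop _ isTop_top)⟩, fun S => ?_⟩,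
      fun _ => rfl⟩
    · have := hf.isGLB_image {a, b} (Set.toFinite _) ⟨a, by simp⟩ (a ⊓ b) isGLB_pair
      rw [Set.image_pair] at this
      exact this.unique isGLB_pair
    · exact (hf.isLUB_image S _ (isLUB_sSup S)).unique (isLUB_sSup _)

end Frame

/-! ### Closures and upper sets of finite sets -/

section Generated

variable {P : Type u} [PartialOrder P]

theorem upperBounds_scottClosure (S : Set P) : upperBounds (scottClosure S) = upperBounds S :=
  (upperBounds_mono_set (subset_scottClosure S)).antisymm
    fun b hb => scottClosure_subset (scottClosed_Iic b) hb

theorem isLUB_scottClosure_iff {S : Set P} {a : P} : IsLUB (scottClosure S) a ↔ IsLUB S a := by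
  rw [IsLUB, upperBounds_scottClosure, IsLUB]

/-- The upper set generated by a nonempty finite set, as a nonempty compact saturated set. -/
def Smyth.ofFinite (F : Set P) (hF : F.Finite) (hne : F.Nonempty) : Smyth P where
  carrier := {y | ∃ x ∈ F, x ≤ y}
  nonempty := hne.imp fun x hx => ⟨x, hx, le_rfl⟩
  compact := ScottCompact.up_image (f := id) ScottContinuous.id
    (@Set.Finite.isCompact P (Topology.scott P Set.univ) F hF)
  upper := fun _ _ h ⟨x, hx, hxy⟩ => ⟨x, hx, hxy.trans h⟩

theorem isGLB_setOf_exists_le_iff {S : Set P} {a : P} :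
    IsGLB {y | ∃ x ∈ S, x ≤ y} a ↔ IsGLB S a := by
  have : lowerBounds {y | ∃ x ∈ S, x ≤ y} = lowerBounds S :=
    Set.Subset.antisymm (fun b hb x hx => hb ⟨x, hx, le_rfl⟩)
      fun b hb y ⟨x, hx, hxy⟩ => (hb hx).trans hxy
  rw [IsGLB, this, IsGLB]

theorem Smyth.map_pure {Q : Type v} [PartialOrder Q] {f : P → Q} (hf : ScottContinuous f) (x : P) :
    Smyth.map f hf (Smyth.pure x) = Smyth.pure (f x) :=
  le_antisymm (fun _ hy => ⟨x, Set.self_mem_Ici, hy⟩)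
    fun _ ⟨_, hz, hzy⟩ => (hf.monotone hz).trans hzy

end Generated

/-! ### The structure map of an algebra -/

section Algebra

variable (A : QH.{u}.Algebra)

/-- The structure map `α : Q(H(L)) → L` of a `QH`-algebra, as a map between posets. -/
def structureMap : Smyth (Hoare A.A) → A.A := WF.fn A.a

theorem scottContinuous_structureMap : ScottContinuous (structureMap A) :=
  WF.scottContinuous_fn A.a

theorem structureMap_unit (x : A.A) : structureMap A (Smyth.pure (Hoare.pure x)) = x :=
  congrArg (fun f => WF.fn f x) A.unit

theorem structureMap_assoc (𝒦 : Smyth (Hoare (Smyth (Hoare A.A)))) :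
    structureMap A (Smyth.map Hoare.join Hoare.scottContinuous_join
      (Smyth.join Hoare.wellFiltered (Smyth.map phiFun
        (scottContinuous_phiFun Hoare.wellFiltered) 𝒦))) =
      structureMap A (Smyth.map (Hoare.map (structureMap A))
        (Hoare.scottContinuous_map (scottContinuous_structureMap A)) 𝒦) :=
  congrArg (fun f : QH.obj (QH.obj A.A) ⟶ A.A => WF.fn f 𝒦) A.assoc

theorem isLUB_structureMap_pure (C : Hoare A.A) :
    IsLUB C.carrier (structureMap A (Smyth.pure C)) := by
  have hmono : Monotone fun C : Hoare A.A => structureMap A (Smyth.pure C) :=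
    (scottContinuous_structureMap A).monotone.comp Smyth.scottContinuous_pure.monotone
  constructor
  · intro x hx
    simpa only [structureMap_unit] using hmono (Hoare.pure_le_iff.2 hx)
  · intro b hb
    simpa only [structureMap_unit] using hmono (show C ≤ Hoare.pure b from hb)

theorem isGLB_structureMap_map_pure (K : Smyth A.A) :
    IsGLB K.carrier (structureMap A (Smyth.map Hoare.pure Hoare.scottContinuous_pure K)) := by
  have hmono : Monotone fun K : Smyth A.A =>
      structureMap A (Smyth.map Hoare.pure Hoare.scottContinuous_pure K) :=
    (scottContinuous_structureMap A).monotone.comp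
      (Smyth.scottContinuous_map A.A.wellFiltered Hoare.scottContinuous_pure).monotone
  constructor
  · intro x hx
    simpa only [Smyth.map_pure, structureMap_unit] using hmono (Smyth.le_pure_iff.2 hx)
  · intro b hb
    simpa only [Smyth.map_pure, structureMap_unit] using hmono (show Smyth.pure b ≤ K from hb)

theorem exists_isLUB_algebra (S : Set A.A) : ∃ a, IsLUB S a :=
  ⟨_, isLUB_scottClosure_iff.1 (isLUB_structureMap_pure A ⟨_, scottClosed_closure S⟩)⟩

/-- The structure map is `𝒦 ↦ ⋀ {⋁ C | C ∈ 𝒦}`. This is the associativity law at the image of `𝒦`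
under `C ↦ ↓(↑C)`. -/
theorem isGLB_structureMap (𝒦 : Smyth (Hoare A.A)) :
    IsGLB {y | ∃ C ∈ 𝒦.carrier, IsLUB C.carrier y} (structureMap A 𝒦) := by
  have hsup : ScottContinuous fun C : Hoare A.A => structureMap A (Smyth.pure C) :=
    Smyth.scottContinuous_pure.comp (scottContinuous_structureMap A)
  have hgen : ScottContinuous fun C : Hoare A.A => Hoare.pure (Smyth.pure C) :=
    Smyth.scottContinuous_pure.comp Hoare.scottContinuous_pure
  have hassoc := structureMap_assoc A (Smyth.map _ hgen 𝒦)
  have hleft : Smyth.map Hoare.join Hoare.scottContinuous_join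
      (Smyth.join Hoare.wellFiltered (Smyth.map phiFun
        (scottContinuous_phiFun Hoare.wellFiltered) (Smyth.map _ hgen 𝒦))) = 𝒦 := by
    refine le_antisymm (fun C hC => ?_) ?_
    · exact ⟨Hoare.pure C, ⟨_, ⟨_, ⟨C, hC, le_rfl⟩, le_rfl⟩,
        fun K hK => ⟨C, Set.self_mem_Iic, hK Set.self_mem_Ici⟩⟩, Hoare.join_le_iff.2 fun _ h => h⟩
    · rintro B ⟨𝒞, ⟨M, ⟨𝒟, ⟨C, hC, hC𝒟⟩, h𝒟M⟩, hM⟩, hB⟩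
      obtain ⟨E, hE, hCE⟩ := h𝒟M hM _ (hC𝒟 Set.self_mem_Iic)
      exact 𝒦.upper ((show C ≤ E from hCE).trans (Hoare.join_le_iff.1 hB E hE)) hC
  have hright : Smyth.map (Hoare.map (structureMap A))
      (Hoare.scottContinuous_map (scottContinuous_structureMap A)) (Smyth.map _ hgen 𝒦) =
      Smyth.map Hoare.pure Hoare.scottContinuous_pure (Smyth.map _ hsup 𝒦) := by
    have hpure (C : Hoare A.A) : Hoare.map (structureMap A) (Hoare.pure (Smyth.pure C)) =
        Hoare.pure (structureMap A (Smyth.pure C)) :=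
      le_antisymm (Hoare.map_le_iff.2 fun _ h => (scottContinuous_structureMap A).monotone h)
        (Hoare.pure_le_iff.2 (Hoare.mem_map Set.self_mem_Iic))
    refine le_antisymm ?_ ?_
    · rintro B ⟨y, ⟨C, hC, hCy⟩, hyB⟩
      refine ⟨_, ⟨C, hC, le_rfl⟩, (hpure C).le.trans (le_trans ?_ hyB)⟩
      exact Hoare.scottContinuous_pure.monotone hCy
    · rintro B ⟨𝒟, ⟨C, hC, hC𝒟⟩, h𝒟B⟩
      refine ⟨_, ⟨C, hC, le_rfl⟩, (hpure C).ge.trans (le_trans ?_ h𝒟B)⟩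
      exact (Hoare.scottContinuous_map (scottContinuous_structureMap A)).monotone hC𝒟
  rw [hleft, hright] at hassoc
  rw [hassoc]
  refine isGLB_setOf_exists_le_iff.1 ?_
  convert isGLB_structureMap_map_pure A (Smyth.map _ hsup 𝒦) using 1
  ext y
  constructor
  · rintro ⟨x, ⟨C, hC, hx⟩, hxy⟩
    exact ⟨C, hC, ((isLUB_structureMap_pure A C).unique hx).le.trans hxy⟩
  · rintro ⟨C, hC, hCy⟩
    exact ⟨_, ⟨C, hC, isLUB_structureMap_pure A C⟩, hCy⟩

/-- The induced algebras of `H` and `Q` are compatible with `φ`: the element `α(φ(𝒜))` is the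
supremum of the infima `α(Qη(K))` of the members `K` of `𝒜`. This is the associativity law at
`↑(HQη(𝒜))`. -/
theorem isLUB_structureMap_phiFun (𝒜 : Hoare (Smyth A.A)) :
    IsLUB ((fun K => structureMap A (Smyth.map Hoare.pure Hoare.scottContinuous_pure K)) ''
      𝒜.carrier) (structureMap A (phiFun 𝒜)) := by
  have hassoc := structureMap_assoc A
    (Smyth.pure (Hoare.map (Smyth.map Hoare.pure Hoare.scottContinuous_pure) 𝒜))
  rw [Smyth.map_pure, Smyth.map_pure] at hassoc
  have hleft : Smyth.map Hoare.join Hoare.scottContinuous_join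
      (Smyth.join Hoare.wellFiltered (Smyth.pure (phiFun
        (Hoare.map (Smyth.map Hoare.pure Hoare.scottContinuous_pure) 𝒜)))) = phiFun 𝒜 := by
    refine le_antisymm (fun B hB => ?_) ?_
    · refine ⟨Hoare.pure B, ⟨_, Set.self_mem_Ici, (mem_phiFun Hoare.wellFiltered).2
        (Hoare.map_le_iff.2 fun K hK => ?_)⟩, Hoare.join_le_iff.2 fun _ h => h⟩
      obtain ⟨x, hxB, hxK⟩ := hB K hK
      exact ⟨Hoare.pure x, Hoare.pure_le_iff.2 hxB, x, hxK, le_rfl⟩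
    · rintro B ⟨𝒞, ⟨M, hM, h𝒞⟩, hB⟩ K hK
      obtain ⟨C, hC, x, hxK, hxC⟩ := hM h𝒞 _ (Hoare.mem_map hK)
      exact ⟨x, Hoare.join_le_iff.1 hB C hC (Hoare.pure_le_iff.1 hxC), hxK⟩
  rw [hleft] at hassoc
  rw [hassoc]
  have hmap := isLUB_structureMap_pure A (Hoare.map (structureMap A)
    (Hoare.map (Smyth.map Hoare.pure Hoare.scottContinuous_pure) 𝒜))
  have hcomp : ∀ b : A.A,
      Hoare.map (structureMap A) (Hoare.map (Smyth.map Hoare.pure Hoare.scottContinuous_pure) 𝒜) ≤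
        Hoare.pure b ↔
      b ∈ upperBounds ((fun K =>
        structureMap A (Smyth.map Hoare.pure Hoare.scottContinuous_pure K)) '' 𝒜.carrier) := by
    intro b
    rw [mem_upperBounds, Set.forall_mem_image, Hoare.map_le_iff]
    exact Hoare.map_le_iff (B := ⟨_, scottClosed_preimage (scottContinuous_structureMap A)
      (scottClosed_Iic b)⟩)
  exact ⟨(hcomp _).1 hmap.1, fun b hb => hmap.2 ((hcomp b).2 hb)⟩

variable {A}

/-- Binary infima in a `QH`-algebra distribute over suprema. -/
theorem le_of_forall_lowerBounds_le {x : A.A} {S : Set A.A} {a : A.A} (ha : IsLUB S a) {b c : A.A}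
    (hcx : c ≤ x) (hca : c ≤ a) (hb : ∀ s ∈ S, ∀ m, m ≤ x → m ≤ s → m ≤ b) : c ≤ b := by
  let pair (s : A.A) : Smyth A.A := Smyth.ofFinite {x, s} (Set.toFinite _) ⟨x, by simp⟩
  let 𝒜 : Hoare (Smyth A.A) := ⟨scottClosure (pair '' S), scottClosed_closure _⟩
  have hinf : ScottContinuous fun K : Smyth A.A =>
      structureMap A (Smyth.map Hoare.pure Hoare.scottContinuous_pure K) :=
    (Smyth.scottContinuous_map A.A.wellFiltered Hoare.scottContinuous_pure).comp
      (scottContinuous_structureMap A)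
  calc
    c ≤ structureMap A (phiFun 𝒜) := by
      refine (isGLB_structureMap A (phiFun 𝒜)).2 ?_
      rintro y ⟨C, hC, hy⟩
      -- A closed set that meets every `↑{x, s}` contains `x` or includes `S`.
      by_cases hxC : x ∈ C.carrier
      · exact hcx.trans (hy.1 hxC)
      · refine hca.trans (ha.2 fun s hs => hy.1 ?_)
        obtain ⟨z, hzC, w, hw, hwz⟩ := hC _ (subset_scottClosure _ ⟨s, hs, rfl⟩)
        obtain rfl | rfl : w = x ∨ w = s := by simpa using hw
        · exact absurd (C.closed.lower hwz hzC) hxC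
        · exact C.closed.lower hwz hzC
    _ ≤ b := by
      refine (isLUB_structureMap_phiFun A 𝒜).2 ?_
      rintro _ ⟨K, hK, rfl⟩
      refine scottClosure_subset (scottClosed_preimage hinf (scottClosed_Iic b)) ?_ hK
      rintro _ ⟨s, hs, rfl⟩
      have h := (isGLB_structureMap_map_pure A (pair s)).1
      exact hb s hs _ (h ⟨x, by simp, le_rfl⟩) (h ⟨s, by simp, le_rfl⟩)

/-- The carrier of every `QH`-algebra is a frame. -/
theorem isFrame_algebra (A : QH.{u}.Algebra) : IsFrame A.A :=
  isFrame_of_isLUB (exists_isLUB_algebra A)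
    fun _ _ _ ha _ _ hcx hca hb => le_of_forall_lowerBounds_le ha hcx hca hb

/-! ### Homomorphisms and uniqueness -/

variable {B : QH.{u}.Algebra}

theorem fn_structureMap (h : A ⟶ B) (𝒦 : Smyth (Hoare A.A)) :
    WF.fn h.f (structureMap A 𝒦) = structureMap B (Smyth.map (Hoare.map (WF.fn h.f))
      (Hoare.scottContinuous_map (WF.scottContinuous_fn h.f)) 𝒦) :=
  (congrArg (fun f : QH.obj A.A ⟶ B.A => WF.fn f 𝒦) h.h).symm

theorem preservesSupsAndFiniteInfs_hom (h : A ⟶ B) :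
    PreservesSupsAndFiniteInfs (WF.fn h.f) where
  isLUB_image S a ha := by
    let C : Hoare A.A := ⟨scottClosure S, scottClosed_closure S⟩
    have hC := (isLUB_structureMap_pure A C).unique (isLUB_scottClosure_iff.2 ha)
    have hlub := isLUB_scottClosure_iff.1
      (isLUB_structureMap_pure B (Hoare.map (WF.fn h.f) C))
    rw [← Smyth.map_pure (Hoare.scottContinuous_map (WF.scottContinuous_fn h.f)),
      ← fn_structureMap, hC] at hlub
    refine ⟨(WF.monotone_fn h.f).mem_upperBounds_image ha.1, fun b hb => hlub.2 ?_⟩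
    rintro _ ⟨x, hx, rfl⟩
    exact scottClosure_subset
      (scottClosed_preimage (WF.scottContinuous_fn h.f) (scottClosed_Iic b))
      (fun s hs => hb ⟨s, hs, rfl⟩) hx
  isGLB_image S hS hne a ha := by
    have hK := (isGLB_structureMap_map_pure A (Smyth.ofFinite S hS hne)).unique
      (isGLB_setOf_exists_le_iff.2 ha)
    refine ⟨(WF.monotone_fn h.f).mem_lowerBounds_image ha.1, fun b hb => ?_⟩
    rw [← hK, fn_structureMap]
    refine (isGLB_structureMap B _).2 ?_
    rintro y ⟨C, ⟨D, ⟨x, ⟨s, hs, hsx⟩, hxD⟩, hDC⟩, hy⟩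
    exact (hb ⟨s, hs, rfl⟩).trans (hy.1 (hDC (Hoare.mem_map (hxD hsx))))

theorem algebra_ext {A B : QH.{u}.Algebra} (h : A.A = B.A) : A = B := by
  obtain ⟨L, α, hα, hα'⟩ := A
  obtain ⟨M, β, hβ, hβ'⟩ := B
  obtain rfl : L = M := h
  obtain rfl : α = β := WF.hom_ext fun 𝒦 =>
    (isGLB_structureMap ⟨L, α, hα, hα'⟩ 𝒦).unique (isGLB_structureMap ⟨L, β, hβ, hβ'⟩ 𝒦)
  rfl

end Algebra

end WFPower

theorem mainTheorem2 :
    (∀ A : WFPower.QH.{u}.Algebra, IsIso (WFPower.phi.law.app A.A) → WFPower.IsFrame A.A) ∧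
    (∀ (A B : WFPower.QH.{u}.Algebra) (h : A ⟶ B),
      WFPower.PreservesSupsAndFiniteInfs (WFPower.WF.fn h.f)) ∧
    (∀ (A B : WFPower.QH.{u}.Algebra) (h : A ⟶ B), IsIso (WFPower.phi.law.app A.A) →
      IsIso (WFPower.phi.law.app B.A) →
      (WFPower.IsFrmMorphism (WFPower.WF.fn h.f) ↔
        ∀ a : A.A, IsTop a → IsTop (WFPower.WF.fn h.f a))) ∧
    (∀ A B : WFPower.QH.{u}.Algebra, A.A = B.A → A = B) :=
  ⟨fun A _ => WFPower.isFrame_algebra A,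
    fun _ _ h => WFPower.preservesSupsAndFiniteInfs_hom h,
    fun A B h _ _ => (WFPower.preservesSupsAndFiniteInfs_hom h).isFrmMorphism_iff
      (WFPower.isFrame_algebra A) (WFPower.isFrame_algebra B),
    fun _ _ h => WFPower.algebra_ext h⟩
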